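/- Consider the Gaussian Y-channel with three users, a relay, real channel gains $h_1,h_2,h_3$ and power $P\ge 0$. For every ordered pair of distinct users $(j,k)$, user $j$ has a message $m_{jk}$ for user $k$; the six messages are independent, $m_{jk}$ being uniform on $\{1,\dots,\lfloor 2^{nR_{jk}}\rfloor\}$. At time $i\in\{1,\dots,n\}$ the relay receives $y_{ri}=h_1x_{1i}+h_2x_{2i}+h_3x_{3i}+z_{ri}$ and user $j$ receives $y_{ji}=h_jx_{ri}+z_{ji}$, where all noise variables $z_{ri},z_{ji}$ are independent, standard Gaussian, and independent of the messages. A code of block length $n$ with non-restricted encoding consists of (measurable) encoders $x_{ji}=f_{ji}(m_{jk},m_{jl},y_j^{i-1})$ at the users, where $y_j^{i-1}=(y_{j1},\dots,y_{j,i-1})$, relay encoders $x_{ri}=f_{ri}(y_r^{i-1})$, and decoders $(\hat m_{kj},\hat m_{lj})=g_j(y_j^n,m_{jk},m_{jl})$, for $\{j,k,l\}=\{1,2,3\}$, such that $\frac1n\sum_{i=1}^n\mathbb E[X_{ji}^2]\le P$ for $j=1,2,3$ and $\frac1n\sum_{i=1}^n\mathbb E[X_{ri}^2]\le P$. A rate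 tuple $\vec R=(R_{12},R_{13},R_{21},R_{23},R_{31},R_{32})\in\mathbb R_{\ge0}^6$ is achievable if there is a sequence of such codes, one for each block length $n$, for which the probability that some user decodes one of its two messages incorrectly tends to $0$ as $n\to\infty$. Let $C(x)=\frac12\log_2(1+x)$. If $\vec R$ is achievable, then $$R_{kj}+R_{lj}+R_{kl}\le C\big((|h_k|+|h_l|)^2P\big)$$ for all distinct $j,k,l\in\{1,2,3\}$. -/

import Mathlib

open MeasureTheory ProbabilityTheory Filter Topology
open scoped ENNReal

noncomputable section

namespace YChannel

/-- The two users other than user `j`. -/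
abbrev Other (j : Fin 3) : Type := {k : Fin 3 // k ≠ j}

/-- A vector of six rates; `R j k` is the rate `R_{jk}` of the message from user `j` to user `k`. -/
abbrev RateTuple : Type := (j : Fin 3) → Other j → ℝ

/-- The function `C(x) = (1/2) log₂ (1 + x)`, in bits. -/
def gaussianC (x : ℝ) : ℝ := 1 / 2 * Real.logb 2 (1 + x)

/-- The message set of the pair `(j, k)`: the integers between `1` and `2 ^ (n R_{jk})`
(relabelled to start from `0`). -/
abbrev MessageSet (R : RateTuple) (n : ℕ) (j : Fin 3) (k : Other j) : Type :=
  Fin ⌊(2 : ℝ) ^ ((n : ℝ) * R j k)⌋₊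

/-- The pair of messages that user `j` wants to send, one to each other user. -/
abbrev Outgoing (R : RateTuple) (n : ℕ) (j : Fin 3) : Type :=
  (k : Other j) → MessageSet R n j k

/-- The pair of messages that user `j` wants to decode, one from each other user. -/
abbrev Incoming (R : RateTuple) (n : ℕ) (j : Fin 3) : Type :=
  (k : Other j) → MessageSet R n k.1 ⟨j, k.2.symm⟩

/-- The vector of all six messages. -/
abbrev Messages (R : RateTuple) (n : ℕ) : Type := (j : Fin 3) → Outgoing R n j

/-- The messages intended for user `j`. -/
def intendedFor {R : RateTuple} {n : ℕ} (m : Messages R n) (j : Fin 3) : Incoming R n j :=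
  fun k => m k.1 ⟨j, k.2.symm⟩

/-- Noise realisations over `n` channel uses: at the three users, and at the relay. -/
abbrev Noise (n : ℕ) : Type := (Fin 3 → Fin n → ℝ) × (Fin n → ℝ)

/-- A code of rate tuple `R` and block length `n` with non-restricted (feedback-dependent)
encoding. Time instants are `i : Fin n`, and `Fin i → ℝ` is the space of the symbols
received strictly before time `i`. -/
structure Code (R : RateTuple) (n : ℕ) where
  /-- `x_{ji}` as a function of the messages of user `j` and of its past received symbols -/
  enc : (j : Fin 3) → (i : Fin n) → Outgoing R n j → (Fin i → ℝ) → ℝ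
  /-- `x_{ri}` as a function of the past received symbols of the relay -/
  relayEnc : (i : Fin n) → (Fin i → ℝ) → ℝ
  /-- the decoder of user `j`, which sees its received sequence and its own messages -/
  dec : (j : Fin 3) → (Fin n → ℝ) → Outgoing R n j → Incoming R n j
  measurable_enc : ∀ j i w, Measurable (enc j i w)
  measurable_relayEnc : ∀ i, Measurable (relayEnc i)
  measurable_dec : ∀ j w, Measurable (fun y => dec j y w)

namespace Code

variable {R : RateTuple} {n : ℕ}

/-- The symbols received at time `i` by the three users (first component) and by the relay
(second component), when the messages are `m`, the noise is `z` and the channel gains are `h`: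
`y_{ji} = h_j x_{ri} + z_{ji}` and `y_{ri} = h_1 x_{1i} + h_2 x_{2i} + h_3 x_{3i} + z_{ri}`. -/
def received (c : Code R n) (h : Fin 3 → ℝ) (m : Messages R n) (z : Noise n) (i : Fin n) :
    (Fin 3 → ℝ) × ℝ :=
  (fun j => h j * c.relayEnc i (fun t => (received c h m z ⟨t, t.2.trans i.2⟩).2) + z.1 j i,
    (∑ j, h j * c.enc j i (m j) (fun t => (received c h m z ⟨t, t.2.trans i.2⟩).1 j)) + z.2 i)
termination_by i.1
decreasing_by all_goals exact t.2

/-- The symbol `x_{ji}` transmitted by user `j` at time `i`. -/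
def userSymbol (c : Code R n) (h : Fin 3 → ℝ) (m : Messages R n) (z : Noise n)
    (j : Fin 3) (i : Fin n) : ℝ :=
  c.enc j i (m j) (fun t => (c.received h m z ⟨t, t.2.trans i.2⟩).1 j)

/-- The symbol `x_{ri}` transmitted by the relay at time `i`. -/
def relaySymbol (c : Code R n) (h : Fin 3 → ℝ) (m : Messages R n) (z : Noise n)
    (i : Fin n) : ℝ :=
  c.relayEnc i (fun t => (c.received h m z ⟨t, t.2.trans i.2⟩).2)

/-- The estimates that user `j` makes of the two messages intended for it. -/
def estimate (c : Code R n) (h : Fin 3 → ℝ) (m : Messages R n) (z : Noise n) (j : Fin 3) :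
    Incoming R n j :=
  c.dec j (fun i => (c.received h m z i).1 j) (m j)

end Code

/-- The law of the noise: all components are independent standard Gaussian variables. -/
def noiseLaw (n : ℕ) : Measure (Noise n) :=
  (Measure.pi fun _ => Measure.pi fun _ => gaussianReal 0 1).prod
    (Measure.pi fun _ => gaussianReal 0 1)

/-- The joint law of the messages and the noise: the message vector is uniform on the product
of the message sets, and independent of the noise. -/
def jointLaw (R : RateTuple) (n : ℕ) : Measure (Messages R n × Noise n) :=
  (uniformOn (Set.univ : Set (Messages R n))).prod (noiseLaw n)

/-- The average power constraints `(1/n) ∑ i, E[X_i ^ 2] ≤ P` at the three users and at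
the relay. -/
def Code.PowerConstraint {R : RateTuple} {n : ℕ} (c : Code R n) (h : Fin 3 → ℝ) (P : ℝ) : Prop :=
  (∀ j, (n : ℝ≥0∞)⁻¹ * ∑ i, ∫⁻ ω, ENNReal.ofReal (c.userSymbol h ω.1 ω.2 j i ^ 2) ∂(jointLaw R n)
      ≤ ENNReal.ofReal P) ∧
  (n : ℝ≥0∞)⁻¹ * ∑ i, ∫⁻ ω, ENNReal.ofReal (c.relaySymbol h ω.1 ω.2 i ^ 2) ∂(jointLaw R n)
      ≤ ENNReal.ofReal P

/-- The average probability that some user decodes one of its messages wrongly. -/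
def Code.errorProb {R : RateTuple} {n : ℕ} (c : Code R n) (h : Fin 3 → ℝ) : ℝ≥0∞ :=
  jointLaw R n {ω | ∃ j, c.estimate h ω.1 ω.2 j ≠ intendedFor ω.1 j}

/-- Achievability of a rate tuple over the non-restricted Gaussian Y-channel with channel
gains `h` and power `P`. -/
def Achievable (h : Fin 3 → ℝ) (P : ℝ) (R : RateTuple) : Prop :=
  (∀ j k, 0 ≤ R j k) ∧
  ∃ c : (n : ℕ) → Code R n, (∀ n, (c n).PowerConstraint h P) ∧
    Tendsto (fun n => (c n).errorProb h) atTop (𝓝 0)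

end YChannel

end

/-!
Fix `j` and let a genie give user `j` the message from `l` to `k`. User `j` decodes its own two
messages; the messages from `l` are then all known, so the message from `k` to `l` can be decoded
as user `l` does, and all six messages are determined by what user `j` knows together with the noise
at the users and the sequence received by the relay.

Instead of mutual informations, compare the law of the channel with the law under which the symbols
received by the relay, minus the contribution of user `j`, are independent centered Gaussian of
variance `v`. Under the latter law the sequence received by the relay depends on the messages only
through those of user `j`, so the messages from `k` to `j`, from `l` to `j` and from `k` to `l` are
all decoded correctly with probability at most one over the number of such triples. Fano's
inequality bounds the logarithm of that number by the relative entropy of the two laws, which is at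
most `n / 2 * log v` when `v` bounds the mean power of the residual symbols. Causality makes the
current relay noise uncorrelated with the signals of users `k` and `l`, and the Cauchy–Schwarz
inequality bounds the power of their superposition, so `v = 1 + (|h k| + |h l|) ^ 2 * P` works.
-/

section MeasureTheory

variable {ι : Type*} [Fintype ι] {E : ι → Type*} [∀ i, MeasurableSpace (E i)]

theorem lintegral_fin_prod_eq_prod {n : ℕ} {E : Fin n → Type*} [∀ i, MeasurableSpace (E i)]
    {μ : ∀ i, Measure (E i)} [∀ i, SigmaFinite (μ i)] {f : ∀ i, E i → ℝ≥0∞}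
    (hf : ∀ i, Measurable (f i)) :
    ∫⁻ x, ∏ i, f i (x i) ∂Measure.pi μ = ∏ i, ∫⁻ x, f i x ∂μ i := by
  induction n with
  | zero => simp
  | succ n ih =>
    have hsplit := (measurePreserving_piFinSuccAbove μ 0).symm
    have htail : Measurable fun x : (i : Fin n) → E i.succ => ∏ i, f i.succ (x i) :=
      Finset.measurable_prod _ fun i _ => (hf i.succ).comp (measurable_pi_apply i)
    rw [← hsplit.lintegral_comp (by fun_prop), Fin.prod_univ_succ, ← ih fun i => hf i.succ,
      ← lintegral_prod_mul (hf 0).aemeasurable htail.aemeasurable]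
    simp only [MeasurableEquiv.piFinSuccAbove_symm_apply, Fin.insertNthEquiv_apply,
      Fin.prod_univ_succ]
    rfl

theorem lintegral_fintype_prod_eq_prod {μ : ∀ i, Measure (E i)} [∀ i, SigmaFinite (μ i)]
    {f : ∀ i, E i → ℝ≥0∞} (hf : ∀ i, Measurable (f i)) :
    ∫⁻ x, ∏ i, f i (x i) ∂Measure.pi μ = ∏ i, ∫⁻ x, f i x ∂μ i := by
  let e := (Fintype.equivFin ι).symm
  rw [← (measurePreserving_piCongrLeft μ e).lintegral_comp (by fun_prop)]
  simp_rw [← e.prod_comp, MeasurableEquiv.coe_piCongrLeft, Equiv.piCongrLeft_apply_apply]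
  exact lintegral_fin_prod_eq_prod fun i => hf (e i)

theorem pi_withDensity {μ : ∀ i, Measure (E i)} [∀ i, SigmaFinite (μ i)]
    {f : ∀ i, E i → ℝ≥0∞} (hf : ∀ i, Measurable (f i))
    [∀ i, SigmaFinite ((μ i).withDensity (f i))] :
    Measure.pi (fun i => (μ i).withDensity (f i)) =
      (Measure.pi μ).withDensity fun x => ∏ i, f i (x i) := by
  refine Measure.pi_eq fun s hs => ?_
  rw [withDensity_apply _ (MeasurableSet.univ_pi hs), Measure.restrict_pi_pi,
    lintegral_fintype_prod_eq_prod hf]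
  exact Finset.prod_congr rfl fun i _ => (withDensity_apply _ (hs i)).symm

theorem measurePreserving_update_pi [DecidableEq ι] {μ : ∀ i, Measure (E i)}
    [∀ i, SigmaFinite (μ i)] {i : ι} {f : E i → E i} (hf : MeasurePreserving f (μ i) (μ i)) :
    MeasurePreserving (fun x : ∀ i, E i => Function.update x i (f (x i)))
      (Measure.pi μ) (Measure.pi μ) := by
  have hcoord : ∀ k, MeasurePreserving (Function.update (fun _ => id) i f k) (μ k) (μ k) := by
    intro k
    obtain rfl | hk := eq_or_ne k i
    · simpa only [Function.update_self] using hf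
    · simpa only [Function.update_of_ne hk] using MeasurePreserving.id (μ k)
  convert measurePreserving_pi μ μ hcoord using 1
  ext x k
  obtain rfl | hk := eq_or_ne k i
  · simp only [Function.update_self]
  · simp only [Function.update_of_ne hk, id_eq]

theorem integral_eq_zero_of_comp_eq_neg {Ω : Type*} [MeasurableSpace Ω] {μ : Measure Ω}
    {T : Ω → Ω} (hT : MeasurePreserving T μ μ) {f : Ω → ℝ} (hf : AEStronglyMeasurable f μ)
    (hfT : ∀ ω, f (T ω) = -f ω) : ∫ ω, f ω ∂μ = 0 := by
  have hmap : ∫ ω, f ω ∂μ = ∫ ω, f (T ω) ∂μ := by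
    conv_lhs => rw [← hT.map_eq]
    exact integral_map hT.measurable.aemeasurable (hT.map_eq.symm ▸ hf)
  simp only [hfT, integral_neg] at hmap
  linarith

theorem integral_add_sq_of_integral_mul_eq_zero {Ω : Type*} [MeasurableSpace Ω] {μ : Measure Ω}
    {X Z : Ω → ℝ} (hX : MemLp X 2 μ) (hZ : MemLp Z 2 μ) (hXZ : ∫ ω, X ω * Z ω ∂μ = 0) :
    ∫ ω, (X ω + Z ω) ^ 2 ∂μ = ∫ ω, X ω ^ 2 ∂μ + ∫ ω, Z ω ^ 2 ∂μ := by
  have hcross : Integrable (fun ω => 2 * (X ω * Z ω)) μ := (hX.integrable_mul hZ).const_mul 2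
  have hsum : Integrable (fun ω => X ω ^ 2 + Z ω ^ 2) μ := hX.integrable_sq.add hZ.integrable_sq
  calc ∫ ω, (X ω + Z ω) ^ 2 ∂μ
      = ∫ ω, (X ω ^ 2 + Z ω ^ 2 + 2 * (X ω * Z ω)) ∂μ := by congr 1 with ω; ring
    _ = ∫ ω, X ω ^ 2 ∂μ + ∫ ω, Z ω ^ 2 ∂μ := by
        rw [integral_add hsum hcross, integral_add hX.integrable_sq hZ.integrable_sq,
          integral_const_mul, hXZ, mul_zero, add_zero]

theorem lintegral_uniformOn_univ {α : Type*} [Fintype α] [MeasurableSpace α]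
    [MeasurableSingletonClass α] (f : α → ℝ≥0∞) :
    ∫⁻ a, f a ∂uniformOn Set.univ = (Fintype.card α : ℝ≥0∞)⁻¹ * ∑ a, f a := by
  rw [uniformOn, ProbabilityTheory.cond, Measure.restrict_univ, lintegral_smul_measure,
    lintegral_count, tsum_fintype, Measure.count_univ, ENat.card_eq_coe_fintype_card,
    ENat.toENNReal_coe, smul_eq_mul]

/-- At each `ω`, at most one `a` with `g a = b` contributes to the sum, so the left-hand side is at
most the total mass of the densities `p b`. -/
theorem sum_setLIntegral_le_card_of_injOn {Ω α β : Type*} [MeasurableSpace Ω] {μ : Measure Ω}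
    [Fintype α] [Fintype β] {p : β → Ω → ℝ≥0∞} (hp : ∀ b, Measurable (p b))
    (hp_le : ∀ b, ∫⁻ ω, p b ω ∂μ ≤ 1) {g : α → β} {S : α → Set Ω}
    (hS : ∀ a, MeasurableSet (S a)) (hg : ∀ ω, Set.InjOn g {a | ω ∈ S a}) :
    ∑ a, ∫⁻ ω in S a, p (g a) ω ∂μ ≤ Fintype.card β := by
  classical
  have hpointwise : ∀ ω, ∑ a, (S a).indicator (p (g a)) ω ≤ ∑ b, p b ω := fun ω => by
    have hinj : Set.InjOn g ({a | ω ∈ S a} : Finset α) := by simpa using hg ω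
    simp only [Set.indicator_apply]
    rw [← Finset.sum_filter, ← Finset.sum_image (f := fun b => p b ω) hinj]
    exact Finset.sum_le_sum_of_subset (Finset.subset_univ _)
  calc ∑ a, ∫⁻ ω in S a, p (g a) ω ∂μ
      = ∫⁻ ω, ∑ a, (S a).indicator (p (g a)) ω ∂μ := by
        rw [lintegral_finsetSum _ fun a _ => (hp (g a)).indicator (hS a)]
        exact Finset.sum_congr rfl fun a _ => (lintegral_indicator (hS a) _).symm
    _ ≤ ∫⁻ ω, ∑ b, p b ω ∂μ := lintegral_mono hpointwise
    _ = ∑ b, ∫⁻ ω, p b ω ∂μ := lintegral_finsetSum _ fun b _ => hp b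
    _ ≤ ∑ _b : β, 1 := Finset.sum_le_sum fun b _ => hp_le b
    _ = Fintype.card β := by simp

theorem integrable_of_integrable_log {Ω : Type*} [MeasurableSpace Ω] {μ : Measure Ω} {W : Ω → ℝ}
    (hW : ∀ᵐ ω ∂μ, 0 < W ω) (hlog : Integrable (fun ω => Real.log (W ω)) μ)
    (hfin : ∫⁻ ω, ENNReal.ofReal (W ω) ∂μ ≠ ∞) : Integrable W μ := by
  have hmeas : AEStronglyMeasurable W μ := by
    refine (Real.continuous_exp.comp_aestronglyMeasurable hlog.aestronglyMeasurable).congr ?_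
    filter_upwards [hW] with ω hω using Real.exp_log hω
  exact (lintegral_ofReal_ne_top_iff_integrable hmeas (hW.mono fun _ => le_of_lt)).1 hfin

/-- This is Jensen's inequality, obtained by integrating the tangent to `log` at `a`. -/
theorem integral_log_le_log_of_lintegral_le {Ω : Type*} [MeasurableSpace Ω] {μ : Measure Ω}
    [IsProbabilityMeasure μ] {W : Ω → ℝ} {a : ℝ} (hW : ∀ᵐ ω ∂μ, 0 < W ω) (ha : 0 < a)
    (hlog : Integrable (fun ω => Real.log (W ω)) μ)
    (hle : ∫⁻ ω, ENNReal.ofReal (W ω) ∂μ ≤ ENNReal.ofReal a) :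
    ∫ ω, Real.log (W ω) ∂μ ≤ Real.log a := by
  have hint : Integrable W μ :=
    integrable_of_integrable_log hW hlog (hle.trans_lt ENNReal.ofReal_lt_top).ne
  have hmean : ∫ ω, W ω ∂μ ≤ a := by
    rw [← ofReal_integral_eq_lintegral_ofReal hint (hW.mono fun _ => le_of_lt)] at hle
    exact (ENNReal.ofReal_le_ofReal_iff ha.le).1 hle
  have htangent : ∀ᵐ ω ∂μ, Real.log (W ω) ≤ a⁻¹ * W ω + (Real.log a - 1) := by
    filter_upwards [hW] with ω hω
    have := Real.log_le_sub_one_of_pos (mul_pos (inv_pos.2 ha) hω)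
    rw [Real.log_mul (inv_pos.2 ha).ne' hω.ne', Real.log_inv] at this
    linarith
  calc ∫ ω, Real.log (W ω) ∂μ
      ≤ ∫ ω, (a⁻¹ * W ω + (Real.log a - 1)) ∂μ :=
        integral_mono_ae hlog ((hint.const_mul _).add (integrable_const _)) htangent
    _ = a⁻¹ * ∫ ω, W ω ∂μ + (Real.log a - 1) := by
        rw [integral_add (hint.const_mul _) (integrable_const _), integral_const_mul,
          integral_const, probReal_univ, one_smul]
    _ ≤ a⁻¹ * a + (Real.log a - 1) := by gcongr
    _ = Real.log a := by rw [inv_mul_cancel₀ ha.ne']; ring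

/-- Fano's inequality in change-of-measure form: apply Jensen's inequality to `D`, multiplied by `M`
on `A`. -/
theorem measureReal_mul_log_le_log_two_sub_integral_log {Ω : Type*} [MeasurableSpace Ω]
    {μ : Measure Ω} [IsProbabilityMeasure μ] {D : Ω → ℝ} {A : Set Ω} {M : ℝ}
    (hD : ∀ᵐ ω ∂μ, 0 < D ω) (hlog : Integrable (fun ω => Real.log (D ω)) μ)
    (hD_le : ∫⁻ ω, ENNReal.ofReal (D ω) ∂μ ≤ 1) (hA : MeasurableSet A) (hM : 0 < M)
    (hA_le : ENNReal.ofReal M * ∫⁻ ω in A, ENNReal.ofReal (D ω) ∂μ ≤ 1) :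
    μ.real A * Real.log M ≤ Real.log 2 - ∫ ω, Real.log (D ω) ∂μ := by
  classical
  have hpos : ∀ ω, 0 < A.piecewise (fun _ => M) 1 ω := fun ω => by
    by_cases hω : ω ∈ A <;> simp [hω, hM]
  have hlogW : ∀ᵐ ω ∂μ, Real.log (D ω * A.piecewise (fun _ => M) 1 ω) =
      Real.log (D ω) + A.indicator (fun _ => Real.log M) ω := by
    filter_upwards [hD] with ω hω
    rw [Real.log_mul hω.ne' (hpos ω).ne']
    by_cases hωA : ω ∈ A <;> simp [hωA]
  have hind : Integrable (A.indicator fun _ => Real.log M) μ := (integrable_const _).indicator hA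
  have hmass : ∫⁻ ω, ENNReal.ofReal (D ω * A.piecewise (fun _ => M) 1 ω) ∂μ ≤
      ENNReal.ofReal 2 := by
    have hon : ∫⁻ ω in A, ENNReal.ofReal (D ω * A.piecewise (fun _ => M) 1 ω) ∂μ =
        ENNReal.ofReal M * ∫⁻ ω in A, ENNReal.ofReal (D ω) ∂μ := by
      rw [← lintegral_const_mul' _ _ ENNReal.ofReal_ne_top]
      refine setLIntegral_congr_fun hA fun ω hω => ?_
      simp only [Set.piecewise_eq_of_mem _ _ _ hω, mul_comm (D ω), ENNReal.ofReal_mul hM.le]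
    have hoff : ∫⁻ ω in Aᶜ, ENNReal.ofReal (D ω * A.piecewise (fun _ => M) 1 ω) ∂μ ≤ 1 := by
      refine le_trans (le_of_eq ?_) ((setLIntegral_le_lintegral Aᶜ _).trans hD_le)
      refine setLIntegral_congr_fun hA.compl fun ω hω => ?_
      simp only [Set.piecewise_eq_of_notMem _ _ _ hω, Pi.one_apply, mul_one]
    rw [← lintegral_add_compl _ hA, hon, show ENNReal.ofReal 2 = 1 + 1 by norm_num]
    exact add_le_add hA_le hoff
  have hjensen := integral_log_le_log_of_lintegral_le
    (hD.mono fun ω hω => mul_pos hω (hpos ω)) two_pos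
    ((hlog.add hind).congr (hlogW.mono fun _ => Eq.symm)) hmass
  rw [integral_congr_ae hlogW, integral_add hlog hind, integral_indicator_const _ hA,
    smul_eq_mul] at hjensen
  linarith

end MeasureTheory

section Innovation

variable {n : ℕ} {G : Type*}

/-- The sequence `y` minus a prediction `s i` of each term from the preceding ones. For a channel
with additive noise that receives `y`, this is the noise if `s` is the signal. -/
def innovation [Sub G] (s : (i : Fin n) → (Fin i → G) → G) (y : Fin n → G) (i : Fin n) : G :=
  y i - s i fun t => y ⟨t, t.2.trans i.2⟩

variable [MeasurableSpace G] {s : (i : Fin n) → (Fin i → G) → G}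

theorem measurable_innovation [Sub G] [MeasurableSub₂ G] (hs : ∀ i, Measurable (s i)) :
    Measurable (innovation s) :=
  measurable_pi_iff.2 fun i => (measurable_pi_apply i).sub
    ((hs i).comp (measurable_pi_iff.2 fun _ => measurable_pi_apply _))

theorem measurePreserving_innovation [AddGroup G] [MeasurableAdd G] [MeasurableSub₂ G]
    {μ : Measure G} [SigmaFinite μ] [μ.IsAddRightInvariant] (hs : ∀ i, Measurable (s i)) :
    MeasurePreserving (innovation s) (Measure.pi fun _ => μ) (Measure.pi fun _ => μ) := by
  induction n with
  | zero =>
    convert MeasurePreserving.id (Measure.pi fun _ : Fin 0 => μ) using 2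
  | succ n ih =>
    have hsplit := measurePreserving_piFinSuccAbove (fun _ : Fin (n + 1) => μ) (Fin.last n)
    have hinit := ih fun i => hs i.castSucc
    have hshear := hinit.skew_product (μc := μ) (μd := μ)
      (g := fun (y : Fin n → G) x => x - s (Fin.last n) y)
      (measurable_snd.sub ((hs (Fin.last n)).comp measurable_fst))
      (ae_of_all _ fun y => (measurePreserving_sub_right μ (s (Fin.last n) y)).map_eq)
    have hcomp := (hsplit.symm.comp Measure.measurePreserving_swap).comp
      (hshear.comp (Measure.measurePreserving_swap.comp hsplit))
    refine (congrArg (MeasurePreserving · _ _) ?_).mpr hcomp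
    funext y i
    simp only [MeasurableEquiv.piFinSuccAbove, Fin.insertNthEquiv, Fin.insertNth_last',
      Fin.removeNth_last, Equiv.symm_mk, MeasurableEquiv.symm_mk, MeasurableEquiv.coe_mk,
      Equiv.coe_fn_mk, Function.comp_apply, Prod.swap_prod_mk]
    cases i using Fin.lastCases with
    | last => rw [Fin.snoc_last]; rfl
    | cast i => rw [Fin.snoc_castSucc]; rfl

end Innovation

section Gaussian

variable {ι : Type*} [Fintype ι]

theorem pi_gaussianReal_eq_withDensity (m : ℝ) {v : NNReal} (hv : v ≠ 0) :
    (Measure.pi fun _ : ι => gaussianReal m v) =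
      volume.withDensity fun x => ∏ i, gaussianPDF m v (x i) := by
  have : SigmaFinite ((volume : Measure ℝ).withDensity (gaussianPDF m v)) :=
    gaussianReal_of_var_ne_zero m hv ▸ inferInstance
  simp_rw [gaussianReal_of_var_ne_zero m hv]
  exact pi_withDensity fun _ => measurable_gaussianPDF m v

theorem measurable_prod_gaussianPDF (m : ℝ) (v : NNReal) :
    Measurable fun x : ι → ℝ => ∏ i, gaussianPDF m v (x i) :=
  Finset.measurable_prod _ fun i _ => (measurable_gaussianPDF m v).comp (measurable_pi_apply i)

/-- The density of a sequence whose innovations with respect to `s` are independent centered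
Gaussian of variance `v`. -/
noncomputable def innovationDensity {n : ℕ} (v : NNReal) (s : (i : Fin n) → (Fin i → ℝ) → ℝ)
    (y : Fin n → ℝ) : ℝ≥0∞ :=
  ∏ i, gaussianPDF 0 v (innovation s y i)

theorem measurable_innovationDensity {n : ℕ} (v : NNReal) {s : (i : Fin n) → (Fin i → ℝ) → ℝ}
    (hs : ∀ i, Measurable (s i)) : Measurable (innovationDensity v s) :=
  (measurable_prod_gaussianPDF 0 v).comp (measurable_innovation hs)

theorem lintegral_innovationDensity {n : ℕ} {v : NNReal} (hv : v ≠ 0)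
    {s : (i : Fin n) → (Fin i → ℝ) → ℝ} (hs : ∀ i, Measurable (s i)) :
    ∫⁻ y, innovationDensity v s y = 1 := by
  calc ∫⁻ y, innovationDensity v s y
      = ∫⁻ x : Fin n → ℝ, ∏ i, gaussianPDF 0 v (x i) :=
        (measurePreserving_innovation hs).lintegral_comp (measurable_prod_gaussianPDF 0 v)
    _ = ∏ _i : Fin n, ∫⁻ x, gaussianPDF 0 v x :=
        lintegral_fintype_prod_eq_prod fun _ => measurable_gaussianPDF 0 v
    _ = 1 := by simp only [lintegral_gaussianPDF_eq_one 0 hv, Finset.prod_const_one]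

/-- The density of independent centered Gaussian variables of variance `v` at `x`, divided by
that of independent standard Gaussian variables at `z`. -/
noncomputable def gaussianLikelihoodRatio (v : NNReal) (x z : ι → ℝ) : ℝ :=
  ∏ i, gaussianPDFReal 0 v (x i) / gaussianPDFReal 0 1 (z i)

theorem gaussianLikelihoodRatio_pos {v : NNReal} (hv : v ≠ 0) (x z : ι → ℝ) :
    0 < gaussianLikelihoodRatio v x z :=
  Finset.prod_pos fun _ _ =>
    div_pos (gaussianPDFReal_pos _ _ _ hv) (gaussianPDFReal_pos _ _ _ one_ne_zero)

theorem measurable_gaussianLikelihoodRatio {Ω : Type*} [MeasurableSpace Ω] (v : NNReal)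
    {X Z : Ω → ι → ℝ} (hX : Measurable X) (hZ : Measurable Z) :
    Measurable fun ω => gaussianLikelihoodRatio v (X ω) (Z ω) :=
  Finset.measurable_prod _ fun i _ =>
    ((measurable_gaussianPDFReal 0 v).comp ((measurable_pi_apply i).comp hX)).div
      ((measurable_gaussianPDFReal 0 1).comp ((measurable_pi_apply i).comp hZ))

theorem prod_gaussianPDF_mul_ofReal_gaussianLikelihoodRatio (v : NNReal) (x z : ι → ℝ) :
    (∏ i, gaussianPDF 0 1 (z i)) * ENNReal.ofReal (gaussianLikelihoodRatio v x z) =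
      ∏ i, gaussianPDF 0 v (x i) := by
  rw [gaussianLikelihoodRatio, ENNReal.ofReal_prod_of_nonneg fun i _ =>
    div_nonneg (gaussianPDFReal_nonneg _ _ _) (gaussianPDFReal_nonneg _ _ _),
    ← Finset.prod_mul_distrib]
  refine Finset.prod_congr rfl fun i _ => ?_
  rw [gaussianPDF, gaussianPDF, ← ENNReal.ofReal_mul (gaussianPDFReal_nonneg _ _ _),
    mul_div_cancel₀ _ (gaussianPDFReal_pos _ _ _ one_ne_zero).ne']

theorem setLIntegral_gaussianLikelihoodRatio (v : NNReal) {f : (ι → ℝ) → ι → ℝ}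
    (hf : Measurable f) {S : Set (ι → ℝ)} (hS : MeasurableSet S) :
    ∫⁻ z in S, ENNReal.ofReal (gaussianLikelihoodRatio v (f z) z)
        ∂Measure.pi (fun _ => gaussianReal 0 1) =
      ∫⁻ z in S, ∏ i, gaussianPDF 0 v (f z i) := by
  rw [pi_gaussianReal_eq_withDensity 0 one_ne_zero,
    setLIntegral_withDensity_eq_setLIntegral_mul _ (measurable_prod_gaussianPDF 0 1)
      (measurable_gaussianLikelihoodRatio v (Z := fun z => z) hf measurable_id).ennreal_ofReal hS]
  exact lintegral_congr fun z => prod_gaussianPDF_mul_ofReal_gaussianLikelihoodRatio v (f z) z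

theorem log_gaussianPDFReal (m : ℝ) {v : NNReal} (hv : v ≠ 0) (x : ℝ) :
    Real.log (gaussianPDFReal m v x) =
      -(1 / 2 * Real.log (2 * Real.pi * v)) - (2 * v : ℝ)⁻¹ * (x - m) ^ 2 := by
  have hpos : 0 < 2 * Real.pi * (v : ℝ) := by positivity
  rw [gaussianPDFReal, Real.log_mul (by positivity) (Real.exp_pos _).ne', Real.log_inv,
    Real.log_sqrt hpos.le, Real.log_exp]
  ring

variable {Ω : Type*} [MeasurableSpace Ω] {μ : Measure Ω}

theorem integrable_log_gaussianPDFReal [IsFiniteMeasure μ] {v : NNReal} (hv : v ≠ 0) {X : Ω → ℝ}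
    (hX : MemLp X 2 μ) : Integrable (fun ω => Real.log (gaussianPDFReal 0 v (X ω))) μ := by
  simp only [log_gaussianPDFReal 0 hv, sub_zero]
  exact (integrable_const _).sub (hX.integrable_sq.const_mul _)

theorem integral_log_gaussianPDFReal [IsProbabilityMeasure μ] {v : NNReal} (hv : v ≠ 0)
    {X : Ω → ℝ} (hX : MemLp X 2 μ) :
    ∫ ω, Real.log (gaussianPDFReal 0 v (X ω)) ∂μ =
      -(1 / 2 * Real.log (2 * Real.pi * v)) - (2 * v : ℝ)⁻¹ * ∫ ω, X ω ^ 2 ∂μ := by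
  simp only [log_gaussianPDFReal 0 hv, sub_zero]
  rw [integral_sub (integrable_const _) (hX.integrable_sq.const_mul _), integral_const_mul,
    integral_const, probReal_univ, one_smul]

theorem log_gaussianLikelihoodRatio {v : NNReal} (hv : v ≠ 0) (x z : ι → ℝ) :
    Real.log (gaussianLikelihoodRatio v x z) =
      ∑ i, (Real.log (gaussianPDFReal 0 v (x i)) - Real.log (gaussianPDFReal 0 1 (z i))) := by
  have hx : ∀ i, gaussianPDFReal 0 v (x i) ≠ 0 := fun i => (gaussianPDFReal_pos _ _ _ hv).ne'
  have hz : ∀ i, gaussianPDFReal 0 1 (z i) ≠ 0 := fun i =>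
    (gaussianPDFReal_pos _ _ _ one_ne_zero).ne'
  rw [gaussianLikelihoodRatio, Real.log_prod fun i _ => div_ne_zero (hx i) (hz i)]
  exact Finset.sum_congr rfl fun i _ => Real.log_div (hx i) (hz i)

theorem integrable_log_gaussianLikelihoodRatio [IsFiniteMeasure μ] {v : NNReal} (hv : v ≠ 0)
    {X Z : Ω → ι → ℝ} (hX : ∀ i, MemLp (fun ω => X ω i) 2 μ)
    (hZ : ∀ i, MemLp (fun ω => Z ω i) 2 μ) :
    Integrable (fun ω => Real.log (gaussianLikelihoodRatio v (X ω) (Z ω))) μ := by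
  simp only [log_gaussianLikelihoodRatio hv]
  exact integrable_finsetSum _ fun i _ => (integrable_log_gaussianPDFReal hv (hX i)).sub
    (integrable_log_gaussianPDFReal one_ne_zero (hZ i))

theorem integral_log_gaussianLikelihoodRatio [IsProbabilityMeasure μ] {v : NNReal} (hv : v ≠ 0)
    {X Z : Ω → ι → ℝ} (hX : ∀ i, MemLp (fun ω => X ω i) 2 μ)
    (hZ : ∀ i, MemLp (fun ω => Z ω i) 2 μ) :
    ∫ ω, Real.log (gaussianLikelihoodRatio v (X ω) (Z ω)) ∂μ =
      1 / 2 * ∑ i, ∫ ω, Z ω i ^ 2 ∂μ - (2 * v : ℝ)⁻¹ * ∑ i, ∫ ω, X ω i ^ 2 ∂μ -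
        Fintype.card ι / 2 * Real.log v := by
  have hlog : Real.log (2 * Real.pi * v) = Real.log (2 * Real.pi) + Real.log v :=
    Real.log_mul (by positivity) (by positivity)
  have hX' := fun i => integrable_log_gaussianPDFReal hv (hX i)
  have hZ' := fun i => integrable_log_gaussianPDFReal one_ne_zero (hZ i)
  have hXZ : ∀ i, Integrable (fun ω => Real.log (gaussianPDFReal 0 v (X ω i)) -
      Real.log (gaussianPDFReal 0 1 (Z ω i))) μ := fun i => (hX' i).sub (hZ' i)
  simp only [log_gaussianLikelihoodRatio hv]
  rw [integral_finsetSum _ fun i _ => hXZ i]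
  simp only [integral_sub (hX' _) (hZ' _), integral_log_gaussianPDFReal hv (hX _),
    integral_log_gaussianPDFReal one_ne_zero (hZ _), Finset.sum_sub_distrib, ← Finset.mul_sum,
    Finset.sum_const, Finset.card_univ, nsmul_eq_mul, NNReal.coe_one, mul_one, hlog]
  ring

end Gaussian

section RealInequalities

theorem sq_sum_mul_le_sum_abs_mul_sum {ι : Type*} (s : Finset ι) (a x : ι → ℝ) :
    (∑ i ∈ s, a i * x i) ^ 2 ≤ (∑ i ∈ s, |a i|) * ∑ i ∈ s, |a i| * x i ^ 2 :=
  Finset.sum_sq_le_sum_mul_sum_of_sq_le_mul s (fun _ _ => abs_nonneg _)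
    (fun _ _ => by positivity) fun i _ => by rw [mul_pow, ← sq_abs (a i), sq, mul_assoc]

theorem sub_one_le_logb_floor_two_rpow {x : ℝ} (hx : 0 ≤ x) :
    x - 1 ≤ Real.logb 2 ⌊(2 : ℝ) ^ x⌋₊ := by
  have hone : (1 : ℝ) ≤ 2 ^ x := Real.one_le_rpow one_le_two hx
  have hfloor : (1 : ℝ) ≤ ⌊(2 : ℝ) ^ x⌋₊ := by exact_mod_cast (Nat.one_le_floor_iff _).2 hone
  rw [Real.le_logb_iff_rpow_le one_lt_two (by linarith), Real.rpow_sub_one two_ne_zero]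
  linarith [Nat.lt_floor_add_one ((2 : ℝ) ^ x)]

theorem le_of_tendsto_zero_of_one_sub_mul_le {ε : ℕ → ℝ} {S C a b : ℝ}
    (hε : Tendsto ε atTop (𝓝 0)) (hle : ∀ n : ℕ, (1 - ε n) * (n * S - a) ≤ b + n * C) :
    S ≤ C := by
  have hinv : Tendsto (fun n : ℕ => (n : ℝ)⁻¹) atTop (𝓝 0) := tendsto_inv_atTop_nhds_zero_nat
  have hleft : Tendsto (fun n : ℕ => (1 - ε n) * (S - a * (n : ℝ)⁻¹)) atTop (𝓝 S) := by
    simpa only [sub_zero, mul_zero, one_mul] using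
      (hε.const_sub 1).mul ((hinv.const_mul a).const_sub S)
  have hright : Tendsto (fun n : ℕ => b * (n : ℝ)⁻¹ + C) atTop (𝓝 C) := by
    simpa only [mul_zero, zero_add] using (hinv.const_mul b).add_const C
  refine le_of_tendsto_of_tendsto hleft hright ?_
  filter_upwards [eventually_gt_atTop 0] with n hn
  have hn' : (0 : ℝ) < n := Nat.cast_pos.2 hn
  refine le_of_mul_le_mul_left ?_ hn'
  calc n * ((1 - ε n) * (S - a * (n : ℝ)⁻¹)) = (1 - ε n) * (n * S - a) := by field_simp
    _ ≤ b + n * C := hle n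
    _ = n * (b * (n : ℝ)⁻¹ + C) := by field_simp

end RealInequalities

namespace YChannel

variable {R : RateTuple} {n : ℕ}

section Law

instance : IsProbabilityMeasure (noiseLaw n) := by
  unfold noiseLaw
  infer_instance

theorem lintegral_jointLaw {f : Messages R n × Noise n → ℝ≥0∞} (hf : Measurable f) :
    ∫⁻ ω, f ω ∂jointLaw R n =
      (Fintype.card (Messages R n) : ℝ≥0∞)⁻¹ * ∫⁻ a, ∑ m, ∫⁻ z, f (m, (a, z))
        ∂(Measure.pi fun _ => gaussianReal 0 1)
        ∂(Measure.pi fun _ => Measure.pi fun _ => gaussianReal 0 1) := by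
  have hsection : ∀ m, Measurable fun z => f (m, z) := fun m => hf.comp measurable_prodMk_left
  rw [jointLaw, lintegral_prod _ hf.aemeasurable, lintegral_uniformOn_univ,
    lintegral_finsetSum _ fun m _ => (hsection m).lintegral_prod_right']
  congr 1
  exact Finset.sum_congr rfl fun m _ => lintegral_prod _ (hsection m).aemeasurable

theorem setLIntegral_jointLaw {f : Messages R n × Noise n → ℝ≥0∞} (hf : Measurable f)
    {A : Set (Messages R n × Noise n)} (hA : MeasurableSet A) :
    ∫⁻ ω in A, f ω ∂jointLaw R n =
      (Fintype.card (Messages R n) : ℝ≥0∞)⁻¹ * ∫⁻ a, ∑ m, ∫⁻ z in {z | (m, (a, z)) ∈ A},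
        f (m, (a, z)) ∂(Measure.pi fun _ => gaussianReal 0 1)
        ∂(Measure.pi fun _ => Measure.pi fun _ => gaussianReal 0 1) := by
  rw [← lintegral_indicator hA, lintegral_jointLaw (hf.indicator hA)]
  congr 1
  refine lintegral_congr fun a => Finset.sum_congr rfl fun m _ => ?_
  have hsection : Measurable fun z => (m, ((a, z) : Noise n)) := by fun_prop
  exact lintegral_indicator (hsection hA) fun z => f (m, (a, z))

theorem measurePreserving_neg_relayNoise (i : Fin n) :
    MeasurePreserving (fun ω : Messages R n × Noise n =>
      (ω.1, (ω.2.1, Function.update ω.2.2 i (-ω.2.2 i)))) (jointLaw R n) (jointLaw R n) := by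
  have hneg : MeasurePreserving (fun x : ℝ => -x) (gaussianReal 0 1) (gaussianReal 0 1) :=
    ⟨measurable_neg, by rw [gaussianReal_map_neg, neg_zero]⟩
  exact (MeasurePreserving.id _).prod ((MeasurePreserving.id _).prod
    (measurePreserving_update_pi (μ := fun _ : Fin n => gaussianReal 0 1) hneg))

variable [Nonempty (Messages R n)]

instance : IsProbabilityMeasure (uniformOn (Set.univ : Set (Messages R n))) :=
  isProbabilityMeasure_uniformOn Set.finite_univ Set.univ_nonempty

instance : IsProbabilityMeasure (jointLaw R n) := by
  unfold jointLaw
  infer_instance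

theorem measurePreserving_relayNoise (i : Fin n) :
    MeasurePreserving (fun ω : Messages R n × Noise n => ω.2.2 i) (jointLaw R n)
      (gaussianReal 0 1) := by
  have hnoise : MeasurePreserving Prod.snd (jointLaw R n) (noiseLaw n) :=
    measurePreserving_snd
  have hrelay : MeasurePreserving Prod.snd (noiseLaw n) (Measure.pi fun _ => gaussianReal 0 1) :=
    measurePreserving_snd
  exact (measurePreserving_eval (fun _ : Fin n => gaussianReal 0 1) i).comp (hrelay.comp hnoise)

theorem memLp_relayNoise (i : Fin n) :
    MemLp (fun ω : Messages R n × Noise n => ω.2.2 i) 2 (jointLaw R n) :=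
  (memLp_id_gaussianReal 2).comp_measurePreserving (measurePreserving_relayNoise i)

theorem integral_relayNoise_sq (i : Fin n) :
    ∫ ω : Messages R n × Noise n, ω.2.2 i ^ 2 ∂jointLaw R n = 1 := by
  have hgauss : HasLaw (fun ω : Messages R n × Noise n => ω.2.2 i) (gaussianReal 0 1)
      (jointLaw R n) := (measurePreserving_relayNoise i).hasLaw
  have hmean : ∫ ω : Messages R n × Noise n, ω.2.2 i ∂jointLaw R n = 0 := by
    rw [hgauss.integral_eq, integral_id_gaussianReal]
  rw [← variance_of_integral_eq_zero hgauss.aemeasurable hmean, hgauss.variance_eq,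
    variance_id_gaussianReal, NNReal.coe_one]

end Law

section ThreeUsers

variable {j k l : Fin 3} (hjk : j ≠ k) (hjl : j ≠ l) (hkl : k ≠ l)

include hkl

theorem univ_erase_eq_pair (hjk : j ≠ k) (hjl : j ≠ l) : Finset.univ.erase j = {k, l} := by
  ext x
  simp only [Finset.mem_erase, Finset.mem_univ, Finset.mem_insert, Finset.mem_singleton, and_true]
  omega

theorem forall_other {p : Other j → Prop} (hk : p ⟨k, hjk.symm⟩) (hl : p ⟨l, hjl.symm⟩)
    (x : Other j) : p x := by
  obtain ⟨x, hx⟩ := x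
  obtain rfl | rfl : x = k ∨ x = l := by omega
  exacts [hk, hl]

theorem prod_other {M : Type*} [CommMonoid M] (f : Other j → M) :
    ∏ x, f x = f ⟨k, hjk.symm⟩ * f ⟨l, hjl.symm⟩ := by
  have huniv : (Finset.univ : Finset (Other j)) = {⟨k, hjk.symm⟩, ⟨l, hjl.symm⟩} :=
    Finset.eq_univ_iff_forall.2 (forall_other hjk hjl hkl (by simp) (by simp)) |>.symm
  rw [huniv, Finset.prod_pair (by simpa using hkl)]

theorem card_messages :
    Fintype.card (Messages R n) =
      Fintype.card (MessageSet R n k ⟨j, hjk⟩) * Fintype.card (MessageSet R n l ⟨j, hjl⟩) *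
        Fintype.card (MessageSet R n k ⟨l, hkl.symm⟩) *
        Fintype.card (Outgoing R n j × MessageSet R n l ⟨k, hkl⟩) := by
  have hk : Fintype.card (Outgoing R n k) = _ :=
    Fintype.card_pi.trans (prod_other hjk.symm hkl hjl _)
  have hl : Fintype.card (Outgoing R n l) = _ :=
    Fintype.card_pi.trans (prod_other hjl.symm hkl.symm hjk _)
  rw [Fintype.card_pi, ← Finset.mul_prod_erase _ _ (Finset.mem_univ j),
    univ_erase_eq_pair hkl hjk hjl, Finset.prod_pair hkl, Fintype.card_prod, hk, hl]
  ring

end ThreeUsers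

namespace Code

variable (c : Code R n) (h : Fin 3 → ℝ)

section Measurability

theorem measurable_received (m : Messages R n) (i : Fin n) :
    Measurable fun z => c.received h m z i := by
  induction i using WellFoundedLT.induction with
  | ind i ih =>
    have hpast_user : ∀ j, Measurable fun z (t : Fin i) =>
        (c.received h m z ⟨t, t.2.trans i.2⟩).1 j := fun j =>
      measurable_pi_iff.2 fun t => (measurable_pi_apply j).comp (ih _ t.2).fst
    have hpast_relay : Measurable fun z (t : Fin i) =>
        (c.received h m z ⟨t, t.2.trans i.2⟩).2 := measurable_pi_iff.2 fun t => (ih _ t.2).snd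
    have hunfold : ∀ z, c.received h m z i = _ := fun z => by rw [received]
    simp_rw [hunfold]
    refine Measurable.prodMk (measurable_pi_iff.2 fun j => ?_) ?_
    · exact (((c.measurable_relayEnc i).comp hpast_relay).const_mul _).add (by fun_prop)
    · exact (Finset.measurable_sum _ fun j _ => ((c.measurable_enc j i (m j)).comp
        (hpast_user j)).const_mul _).add (by fun_prop)

theorem measurable_received_user (m : Messages R n) (j : Fin 3) (i : Fin n) :
    Measurable fun z => (c.received h m z i).1 j :=
  (measurable_pi_apply j).comp (c.measurable_received h m i).fst

theorem measurable_userSymbol (j : Fin 3) (i : Fin n) :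
    Measurable fun ω : Messages R n × Noise n => c.userSymbol h ω.1 ω.2 j i :=
  measurable_from_prod_countable_right fun m => (c.measurable_enc j i (m j)).comp
    (measurable_pi_iff.2 fun _ => c.measurable_received_user h m j _)

theorem measurable_estimate (m : Messages R n) (j : Fin 3) :
    Measurable fun z => c.estimate h m z j :=
  (c.measurable_dec j (m j)).comp
    (measurable_pi_iff.2 fun i => c.measurable_received_user h m j i)

/-- The event that every user decodes correctly. -/
def correct : Set (Messages R n × Noise n) :=
  {ω | ∀ j, c.estimate h ω.1 ω.2 j = intendedFor ω.1 j}

theorem measurableSet_correct : MeasurableSet (c.correct h) := by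
  rw [correct, Set.ofPred_forall]
  refine MeasurableSet.iInter fun j => ?_
  have hpair : Measurable fun ω : Messages R n × Noise n =>
      (c.estimate h ω.1 ω.2 j, intendedFor ω.1 j) :=
    measurable_from_prod_countable_right fun m =>
      (c.measurable_estimate h m j).prodMk (measurable_const (a := intendedFor m j))
  exact hpair (Set.to_countable {p : Incoming R n j × Incoming R n j | p.1 = p.2}).measurableSet

theorem measureReal_correct [Nonempty (Messages R n)] :
    (jointLaw R n).real (c.correct h) = 1 - (c.errorProb h).toReal := by
  have hcompl : (c.correct h)ᶜ = {ω | ∃ j, c.estimate h ω.1 ω.2 j ≠ intendedFor ω.1 j} := by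
    ext ω
    simp only [correct, Set.mem_compl_iff, Set.mem_ofPred_eq, not_forall, ne_eq]
  rw [errorProb, ← hcompl, ← measureReal_def, probReal_compl_eq_one_sub (c.measurableSet_correct h),
    sub_sub_cancel]

end Measurability

section Causality

theorem received_congr (m : Messages R n) {a : Fin 3 → Fin n → ℝ} {z z' : Fin n → ℝ} (i : Fin n)
    (hz : ∀ t ≤ i, z t = z' t) : c.received h m (a, z) i = c.received h m (a, z') i := by
  induction i using WellFoundedLT.induction with
  | ind i ih =>
    have hpast : ∀ t : Fin i, c.received h m (a, z) ⟨t, t.2.trans i.2⟩ =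
        c.received h m (a, z') ⟨t, t.2.trans i.2⟩ := fun t =>
      ih _ t.2 fun s hs => hz s (hs.trans (le_of_lt t.2))
    rw [received, received]
    simp only [hpast, hz i le_rfl]

theorem userSymbol_congr (m : Messages R n) {a : Fin 3 → Fin n → ℝ} {z z' : Fin n → ℝ} (j : Fin 3)
    (i : Fin n) (hz : ∀ t < i, z t = z' t) :
    c.userSymbol h m (a, z) j i = c.userSymbol h m (a, z') j i := by
  have hpast : ∀ t : Fin i, c.received h m (a, z) ⟨t, t.2.trans i.2⟩ =
      c.received h m (a, z') ⟨t, t.2.trans i.2⟩ := fun t =>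
    c.received_congr h m _ fun s hs => hz s (lt_of_le_of_lt hs t.2)
  simp only [userSymbol, hpast]

/-- The symbol received by user `j` at time `i` when the relay receives the sequence `y` and the
noise at the users is `a`. -/
def userOutput (a : Fin 3 → Fin n → ℝ) (y : Fin n → ℝ) (j : Fin 3) (i : Fin n) : ℝ :=
  h j * c.relayEnc i (fun t => y ⟨t, t.2.trans i.2⟩) + a j i

/-- The symbol transmitted by user `j` at time `i` with messages `w`, as a function of the symbols
`p` received by the relay before time `i`, when the noise at the users is `a`. -/
def feedbackInput (a : Fin 3 → Fin n → ℝ) (j : Fin 3) (w : Outgoing R n j) (i : Fin n)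
    (p : Fin i → ℝ) : ℝ :=
  c.enc j i w fun t =>
    h j * c.relayEnc ⟨t, t.2.trans i.2⟩ (fun s => p ⟨s, s.2.trans t.2⟩) + a j ⟨t, t.2.trans i.2⟩

/-- The contribution of user `j` to the symbol received by the relay at time `i`, as a function of
the symbols that the relay has received before. -/
def ownSignal (a : Fin 3 → Fin n → ℝ) (j : Fin 3) (w : Outgoing R n j) (i : Fin n)
    (p : Fin i → ℝ) : ℝ :=
  h j * c.feedbackInput h a j w i p

/-- The noiseless part of the symbol received by the relay at time `i`, as a function of the
symbols that the relay has received before. -/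
def superposition (m : Messages R n) (a : Fin 3 → Fin n → ℝ) (i : Fin n) (p : Fin i → ℝ) : ℝ :=
  ∑ j, c.ownSignal h a j (m j) i p

theorem measurable_ownSignal (a : Fin 3 → Fin n → ℝ) (j : Fin 3) (w : Outgoing R n j)
    (i : Fin n) : Measurable (c.ownSignal h a j w i) :=
  ((c.measurable_enc j i w).comp (measurable_pi_iff.2 fun _ => (((c.measurable_relayEnc _).comp
    (measurable_pi_iff.2 fun _ => measurable_pi_apply _)).const_mul _).add_const _)).const_mul _

theorem measurable_superposition (m : Messages R n) (a : Fin 3 → Fin n → ℝ) (i : Fin n) :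
    Measurable (c.superposition h m a i) :=
  Finset.measurable_sum _ fun j _ => c.measurable_ownSignal h a j (m j) i

theorem received_innovation (m : Messages R n) (a : Fin 3 → Fin n → ℝ) (y : Fin n → ℝ)
    (i : Fin n) :
    c.received h m (a, innovation (c.superposition h m a) y) i =
      (fun j => c.userOutput h a y j i, y i) := by
  induction i using WellFoundedLT.induction with
  | ind i ih =>
    have hpast : ∀ t : Fin i, c.received h m (a, innovation (c.superposition h m a) y)
        ⟨t, t.2.trans i.2⟩ = _ := fun t => ih _ t.2
    rw [received]
    simp only [hpast]
    exact Prod.ext rfl (add_sub_cancel _ _)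

theorem userSymbol_innovation (m : Messages R n) (a : Fin 3 → Fin n → ℝ) (y : Fin n → ℝ)
    (j : Fin 3) (i : Fin n) :
    c.userSymbol h m (a, innovation (c.superposition h m a) y) j i =
      c.feedbackInput h a j (m j) i fun t => y ⟨t, t.2.trans i.2⟩ := by
  simp only [userSymbol, received_innovation]
  rfl

end Causality

section Genie

/-- The signal that users other than `j` contribute to the symbol received by the relay. -/
noncomputable def interference (j : Fin 3) (m : Messages R n) (z : Noise n) (i : Fin n) : ℝ :=
  ∑ u ∈ Finset.univ.erase j, h u * c.userSymbol h m z u i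

/-- What remains of the symbol received by the relay without the contribution of user `j`. -/
noncomputable def residual (j : Fin 3) (m : Messages R n) (z : Noise n) (i : Fin n) : ℝ :=
  c.interference h j m z i + z.2 i

theorem measurable_residual (j : Fin 3) :
    Measurable fun ω : Messages R n × Noise n => c.residual h j ω.1 ω.2 :=
  measurable_pi_iff.2 fun i => (Finset.measurable_sum _ fun u _ =>
    (c.measurable_userSymbol h u i).const_mul _).add (by fun_prop)

theorem residual_innovation (j : Fin 3) (m : Messages R n) (a : Fin 3 → Fin n → ℝ)
    (y : Fin n → ℝ) :
    c.residual h j m (a, innovation (c.superposition h m a) y) =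
      innovation (c.ownSignal h a j (m j)) y := by
  ext i
  simp only [residual, interference, userSymbol_innovation, innovation, superposition, ownSignal]
  rw [← Finset.add_sum_erase _ _ (Finset.mem_univ j)]
  ring

/-- The density, with respect to the law of the channel, of the law under which the residuals of
user `j` are independent centered Gaussian of variance `v`. -/
noncomputable def likelihoodRatio (j : Fin 3) (v : NNReal) (ω : Messages R n × Noise n) : ℝ :=
  gaussianLikelihoodRatio v (c.residual h j ω.1 ω.2) ω.2.2

theorem measurable_likelihoodRatio (j : Fin 3) (v : NNReal) :
    Measurable (c.likelihoodRatio h j v) :=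
  measurable_gaussianLikelihoodRatio v (c.measurable_residual h j) measurable_snd.snd

theorem setLIntegral_likelihoodRatio (j : Fin 3) (v : NNReal) (m : Messages R n)
    (a : Fin 3 → Fin n → ℝ) {S : Set (Fin n → ℝ)} (hS : MeasurableSet S) :
    ∫⁻ z in S, ENNReal.ofReal (c.likelihoodRatio h j v (m, (a, z)))
        ∂(Measure.pi fun _ => gaussianReal 0 1) =
      ∫⁻ y in innovation (c.superposition h m a) ⁻¹' S,
        innovationDensity v (c.ownSignal h a j (m j)) y := by
  have hresidual : Measurable fun z => c.residual h j m (a, z) :=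
    (c.measurable_residual h j).comp (measurable_prodMk_left.comp measurable_prodMk_left)
  have hnoise : MeasurePreserving (innovation (c.superposition h m a)) volume volume :=
    measurePreserving_innovation (c.measurable_superposition h m a)
  have hdensity : Measurable fun z => ∏ i, gaussianPDF 0 v (c.residual h j m (a, z) i) :=
    (measurable_prod_gaussianPDF 0 v).comp hresidual
  simp only [likelihoodRatio]
  rw [setLIntegral_gaussianLikelihoodRatio v hresidual hS,
    ← hnoise.setLIntegral_comp_preimage hS hdensity]
  simp only [residual_innovation, innovationDensity]

theorem lintegral_likelihoodRatio [Nonempty (Messages R n)] (j : Fin 3) {v : NNReal} (hv : v ≠ 0) :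
    ∫⁻ ω, ENNReal.ofReal (c.likelihoodRatio h j v ω) ∂jointLaw R n = 1 := by
  have hsection : ∀ a m, ∫⁻ z, ENNReal.ofReal (c.likelihoodRatio h j v (m, (a, z)))
      ∂(Measure.pi fun _ => gaussianReal 0 1) = 1 := fun a m => by
    rw [← setLIntegral_univ, setLIntegral_likelihoodRatio c h j v m a MeasurableSet.univ,
      Set.preimage_univ, setLIntegral_univ,
      lintegral_innovationDensity hv (c.measurable_ownSignal h a j (m j))]
  rw [lintegral_jointLaw (c.measurable_likelihoodRatio h j v).ennreal_ofReal]
  simp only [hsection, lintegral_const, measure_univ, mul_one, Finset.sum_const, Finset.card_univ,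
    nsmul_eq_mul]
  exact ENNReal.inv_mul_cancel (Nat.cast_ne_zero.2 Fintype.card_ne_zero) (ENNReal.natCast_ne_top _)

/-- The side information `s m`, the messages of user `j`, the noise at the users and the sequence
received by the relay determine all messages whenever every user decodes correctly. -/
def IsGenie {β : Type*} (j : Fin 3) (s : Messages R n → β) : Prop :=
  ∀ a y, Set.InjOn (fun m => (m j, s m))
    {m | (m, (a, innovation (c.superposition h m a) y)) ∈ c.correct h}

variable {c h}

theorem intendedFor_eq_of_mem_correct {a : Fin 3 → Fin n → ℝ} {y : Fin n → ℝ}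
    {m m' : Messages R n} (hm : (m, (a, innovation (c.superposition h m a) y)) ∈ c.correct h)
    (hm' : (m', (a, innovation (c.superposition h m' a) y)) ∈ c.correct h) {u : Fin 3}
    (hu : m u = m' u) : intendedFor m u = intendedFor m' u := by
  have hdec := hm u
  have hdec' := hm' u
  simp only [estimate, received_innovation] at hdec hdec'
  rw [← hdec, ← hdec', hu]

theorem isGenie_message {j k l : Fin 3} (hjk : j ≠ k) (hjl : j ≠ l) (hkl : k ≠ l) :
    c.IsGenie h j fun m => m l ⟨k, hkl⟩ := by
  intro a y m hm m' hm' hgenie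
  obtain ⟨hj, hlk⟩ := Prod.ext_iff.1 hgenie
  have hto_j := intendedFor_eq_of_mem_correct hm hm' hj
  have hl : m l = m' l := funext <|
    forall_other hjl.symm hkl.symm hjk (congrFun hto_j ⟨l, hjl.symm⟩) hlk
  have hto_l := intendedFor_eq_of_mem_correct hm hm' hl
  have hk : m k = m' k := funext <|
    forall_other hjk.symm hkl hjl (congrFun hto_j ⟨k, hjk.symm⟩) (congrFun hto_l ⟨k, hkl⟩)
  ext1 u
  obtain rfl | hu := eq_or_ne u j
  · exact hj
  · exact forall_other (p := fun u => m u = m' u) hjk hjl hkl hk hl ⟨u, hu⟩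

theorem IsGenie.sum_setLIntegral_likelihoodRatio_le {β : Type*} [Fintype β] {j : Fin 3}
    {s : Messages R n → β} (hs : c.IsGenie h j s) {v : NNReal} (hv : v ≠ 0)
    (a : Fin 3 → Fin n → ℝ) :
    ∑ m, ∫⁻ z in {z | (m, (a, z)) ∈ c.correct h},
        ENNReal.ofReal (c.likelihoodRatio h j v (m, (a, z)))
          ∂(Measure.pi fun _ => gaussianReal 0 1) ≤
      Fintype.card (Outgoing R n j × β) := by
  have hsection : ∀ m : Messages R n, Measurable fun z => (m, ((a, z) : Noise n)) := fun m => by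
    fun_prop
  have hcorrect : ∀ m, MeasurableSet {z | (m, (a, z)) ∈ c.correct h} := fun m =>
    hsection m (c.measurableSet_correct h)
  have hinj : ∀ y, Set.InjOn (fun m => (m j, s m)) {m | y ∈
      innovation (c.superposition h m a) ⁻¹' {z | (m, (a, z)) ∈ c.correct h}} := fun y => by
    simpa only [Set.mem_preimage, Set.mem_ofPred_eq] using hs a y
  have hle := sum_setLIntegral_le_card_of_injOn (μ := volume)
    (p := fun b : Outgoing R n j × β => innovationDensity v (c.ownSignal h a j b.1))
    (fun b => measurable_innovationDensity v (c.measurable_ownSignal h a j b.1))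
    (fun b => (lintegral_innovationDensity hv (c.measurable_ownSignal h a j b.1)).le)
    (fun m => measurable_innovation (c.measurable_superposition h m a) (hcorrect m)) hinj
  refine (Finset.sum_congr rfl fun m _ => ?_).trans_le hle
  exact setLIntegral_likelihoodRatio c h j v m a (hcorrect m)

theorem IsGenie.card_mul_setLIntegral_correct_le [Nonempty (Messages R n)] {β : Type*} [Fintype β]
    {j : Fin 3} {s : Messages R n → β} (hs : c.IsGenie h j s) {v : NNReal} (hv : v ≠ 0) :
    Fintype.card (Messages R n) *
        ∫⁻ ω in c.correct h, ENNReal.ofReal (c.likelihoodRatio h j v ω) ∂jointLaw R n ≤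
      Fintype.card (Outgoing R n j × β) := by
  rw [setLIntegral_jointLaw (c.measurable_likelihoodRatio h j v).ennreal_ofReal
    (c.measurableSet_correct h), ← mul_assoc, ENNReal.mul_inv_cancel
      (Nat.cast_ne_zero.2 Fintype.card_ne_zero) (ENNReal.natCast_ne_top _), one_mul]
  refine (lintegral_mono (hs.sum_setLIntegral_likelihoodRatio_le hv)).trans_eq ?_
  rw [lintegral_const, measure_univ, mul_one]

theorem IsGenie.ofReal_mul_setLIntegral_correct_le_one [Nonempty (Messages R n)] {β : Type*}
    [Fintype β] {j : Fin 3} {s : Messages R n → β} (hs : c.IsGenie h j s) {v : NNReal} (hv : v ≠ 0)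
    {M : ℕ} (hM : Fintype.card (Messages R n) = M * Fintype.card (Outgoing R n j × β)) :
    ENNReal.ofReal M *
      ∫⁻ ω in c.correct h, ENNReal.ofReal (c.likelihoodRatio h j v ω) ∂jointLaw R n ≤ 1 := by
  have hcard : Fintype.card (Outgoing R n j × β) ≠ 0 := fun h0 =>
    Fintype.card_ne_zero (α := Messages R n) (by rw [hM, h0, mul_zero])
  have hle := hs.card_mul_setLIntegral_correct_le hv
  rw [hM, Nat.cast_mul, mul_comm (M : ℝ≥0∞), mul_assoc] at hle
  rw [ENNReal.ofReal_natCast]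
  refine (ENNReal.mul_le_mul_iff_right (Nat.cast_ne_zero.2 hcard) (ENNReal.natCast_ne_top _)).1 ?_
  rwa [mul_one]

end Genie

section Power

variable {c} {h} {P : ℝ}

theorem PowerConstraint.sum_lintegral_le (hc : c.PowerConstraint h P) (j : Fin 3) :
    ∑ i, ∫⁻ ω, ENNReal.ofReal (c.userSymbol h ω.1 ω.2 j i ^ 2) ∂jointLaw R n ≤
      n * ENNReal.ofReal P := by
  obtain rfl | hn := eq_or_ne n 0
  · simp
  · exact (ENNReal.inv_mul_le_iff (Nat.cast_ne_zero.2 hn) (ENNReal.natCast_ne_top n)).1 (hc.1 j)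

theorem PowerConstraint.memLp_userSymbol (hc : c.PowerConstraint h P) (j : Fin 3) (i : Fin n) :
    MemLp (fun ω => c.userSymbol h ω.1 ω.2 j i) 2 (jointLaw R n) := by
  have hmeas := c.measurable_userSymbol h j i
  have hle : ∫⁻ ω, ENNReal.ofReal (c.userSymbol h ω.1 ω.2 j i ^ 2) ∂jointLaw R n ≤
      n * ENNReal.ofReal P :=
    (Finset.single_le_sum (f := fun i => ∫⁻ ω, ENNReal.ofReal (c.userSymbol h ω.1 ω.2 j i ^ 2)
      ∂jointLaw R n) (fun _ _ => zero_le) (Finset.mem_univ i)).trans (hc.sum_lintegral_le j)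
  rw [memLp_two_iff_integrable_sq hmeas.aestronglyMeasurable,
    ← lintegral_ofReal_ne_top_iff_integrable (hmeas.pow_const 2).aestronglyMeasurable
      (ae_of_all _ fun _ => sq_nonneg _)]
  exact ne_top_of_le_ne_top
    (ENNReal.mul_ne_top (ENNReal.natCast_ne_top n) ENNReal.ofReal_ne_top) hle

theorem PowerConstraint.sum_integral_userSymbol_sq_le (hc : c.PowerConstraint h P) (hP : 0 ≤ P)
    (j : Fin 3) : ∑ i, ∫ ω, c.userSymbol h ω.1 ω.2 j i ^ 2 ∂jointLaw R n ≤ n * P := by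
  have hle := hc.sum_lintegral_le j
  have hofReal : ∀ i, ∫⁻ ω, ENNReal.ofReal (c.userSymbol h ω.1 ω.2 j i ^ 2) ∂jointLaw R n =
      ENNReal.ofReal (∫ ω, c.userSymbol h ω.1 ω.2 j i ^ 2 ∂jointLaw R n) := fun i =>
    (ofReal_integral_eq_lintegral_ofReal (hc.memLp_userSymbol j i).integrable_sq
      (ae_of_all _ fun _ => sq_nonneg _)).symm
  simp only [hofReal] at hle
  rw [← ENNReal.ofReal_sum_of_nonneg fun i _ => integral_nonneg fun _ => sq_nonneg _,
    ← ENNReal.ofReal_natCast, ← ENNReal.ofReal_mul n.cast_nonneg] at hle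
  exact (ENNReal.ofReal_le_ofReal_iff (mul_nonneg n.cast_nonneg hP)).1 hle

theorem PowerConstraint.memLp_interference (hc : c.PowerConstraint h P) (j : Fin 3) (i : Fin n) :
    MemLp (fun ω => c.interference h j ω.1 ω.2 i) 2 (jointLaw R n) :=
  memLp_finsetSum _ fun u _ => (hc.memLp_userSymbol u i).const_mul (h u)

theorem PowerConstraint.sum_integral_interference_sq_le (hc : c.PowerConstraint h P) (hP : 0 ≤ P)
    (j : Fin 3) :
    ∑ i, ∫ ω, c.interference h j ω.1 ω.2 i ^ 2 ∂jointLaw R n ≤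
      n * ((∑ u ∈ Finset.univ.erase j, |h u|) ^ 2 * P) := by
  set g := ∑ u ∈ Finset.univ.erase j, |h u|
  have hsq : ∀ i, ∀ u ∈ Finset.univ.erase j, Integrable (fun ω : Messages R n × Noise n =>
      |h u| * c.userSymbol h ω.1 ω.2 u i ^ 2) (jointLaw R n) := fun i u _ =>
    (hc.memLp_userSymbol u i).integrable_sq.const_mul _
  have hle : ∀ i, ∫ ω, c.interference h j ω.1 ω.2 i ^ 2 ∂jointLaw R n ≤
      g * ∑ u ∈ Finset.univ.erase j,
        |h u| * ∫ ω, c.userSymbol h ω.1 ω.2 u i ^ 2 ∂jointLaw R n := fun i => by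
    simp only [← integral_const_mul, ← integral_finsetSum _ (hsq i)]
    exact integral_mono (hc.memLp_interference j i).integrable_sq
      ((integrable_finsetSum _ (hsq i)).const_mul g) fun ω => sq_sum_mul_le_sum_abs_mul_sum _ _ _
  calc ∑ i, ∫ ω, c.interference h j ω.1 ω.2 i ^ 2 ∂jointLaw R n
      ≤ ∑ i, g * ∑ u ∈ Finset.univ.erase j,
          |h u| * ∫ ω, c.userSymbol h ω.1 ω.2 u i ^ 2 ∂jointLaw R n :=
        Finset.sum_le_sum fun i _ => hle i
    _ = g * ∑ u ∈ Finset.univ.erase j,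
          |h u| * ∑ i, ∫ ω, c.userSymbol h ω.1 ω.2 u i ^ 2 ∂jointLaw R n := by
        rw [← Finset.mul_sum, Finset.sum_comm]
        simp only [Finset.mul_sum]
    _ ≤ g * ∑ u ∈ Finset.univ.erase j, |h u| * (n * P) := by
        gcongr with u
        exact hc.sum_integral_userSymbol_sq_le hP u
    _ = n * (g ^ 2 * P) := by
        rw [← Finset.sum_mul]
        ring

/-- Flipping the sign of the current relay noise preserves the law and negates the product. -/
theorem integral_interference_mul_relayNoise (j : Fin 3) (i : Fin n) :
    ∫ ω, c.interference h j ω.1 ω.2 i * ω.2.2 i ∂jointLaw R n = 0 := by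
  have hmeas : Measurable fun ω : Messages R n × Noise n =>
      c.interference h j ω.1 ω.2 i * ω.2.2 i :=
    (Finset.measurable_sum _ fun u _ => (c.measurable_userSymbol h u i).const_mul _).mul
      (by fun_prop)
  refine integral_eq_zero_of_comp_eq_neg (measurePreserving_neg_relayNoise i)
    hmeas.aestronglyMeasurable fun ω => ?_
  have hcausal : ∀ u, c.userSymbol h ω.1 (ω.2.1, Function.update ω.2.2 i (-ω.2.2 i)) u i =
      c.userSymbol h ω.1 ω.2 u i := fun u =>
    c.userSymbol_congr h ω.1 u i fun t ht => Function.update_of_ne ht.ne _ _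
  simp only [interference, hcausal, Function.update_self, mul_neg]

variable [Nonempty (Messages R n)]

theorem PowerConstraint.memLp_residual (hc : c.PowerConstraint h P) (j : Fin 3) (i : Fin n) :
    MemLp (fun ω => c.residual h j ω.1 ω.2 i) 2 (jointLaw R n) :=
  (hc.memLp_interference j i).add (memLp_relayNoise i)

theorem PowerConstraint.integral_residual_sq (hc : c.PowerConstraint h P) (j : Fin 3)
    (i : Fin n) :
    ∫ ω, c.residual h j ω.1 ω.2 i ^ 2 ∂jointLaw R n =
      ∫ ω, c.interference h j ω.1 ω.2 i ^ 2 ∂jointLaw R n + 1 := by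
  simp only [residual]
  rw [integral_add_sq_of_integral_mul_eq_zero (hc.memLp_interference j i) (memLp_relayNoise i)
    (integral_interference_mul_relayNoise j i), integral_relayNoise_sq]

theorem PowerConstraint.sum_integral_residual_sq_le (hc : c.PowerConstraint h P) (hP : 0 ≤ P)
    (j : Fin 3) :
    ∑ i, ∫ ω, c.residual h j ω.1 ω.2 i ^ 2 ∂jointLaw R n ≤
      n * (1 + (∑ u ∈ Finset.univ.erase j, |h u|) ^ 2 * P) := by
  simp only [hc.integral_residual_sq j, Finset.sum_add_distrib, Finset.sum_const,
    Finset.card_univ, Fintype.card_fin, nsmul_eq_mul, mul_one]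
  linarith [hc.sum_integral_interference_sq_le hP j]

theorem PowerConstraint.integrable_log_likelihoodRatio (hc : c.PowerConstraint h P) (j : Fin 3)
    {v : NNReal} (hv : v ≠ 0) :
    Integrable (fun ω => Real.log (c.likelihoodRatio h j v ω)) (jointLaw R n) :=
  integrable_log_gaussianLikelihoodRatio hv (hc.memLp_residual j) memLp_relayNoise

theorem PowerConstraint.neg_integral_log_likelihoodRatio_le (hc : c.PowerConstraint h P)
    {j : Fin 3} {v : NNReal} (hv : v ≠ 0)
    (hle : ∑ i, ∫ ω, c.residual h j ω.1 ω.2 i ^ 2 ∂jointLaw R n ≤ n * v) :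
    -∫ ω, Real.log (c.likelihoodRatio h j v ω) ∂jointLaw R n ≤ n / 2 * Real.log v := by
  have hnormalized : (2 * v : ℝ)⁻¹ * ∑ i, ∫ ω, c.residual h j ω.1 ω.2 i ^ 2 ∂jointLaw R n ≤
      n / 2 :=
    calc _ ≤ (2 * v : ℝ)⁻¹ * (n * v) := by gcongr
      _ = n / 2 := by field_simp
  simp only [likelihoodRatio]
  rw [integral_log_gaussianLikelihoodRatio hv (hc.memLp_residual j) memLp_relayNoise]
  simp only [integral_relayNoise_sq, Finset.sum_const, Finset.card_univ, Fintype.card_fin,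
    nsmul_eq_mul, mul_one]
  linarith

end Power

section Converse

variable {c} {h} {P : ℝ} [Nonempty (Messages R n)]

theorem IsGenie.one_sub_errorProb_mul_log_le {β : Type*} [Fintype β] {j : Fin 3}
    {s : Messages R n → β} (hs : c.IsGenie h j s) (hc : c.PowerConstraint h P) (hP : 0 ≤ P)
    {M : ℕ} (hM : Fintype.card (Messages R n) = M * Fintype.card (Outgoing R n j × β)) :
    (1 - (c.errorProb h).toReal) * Real.log M ≤
      Real.log 2 + n / 2 * Real.log (1 + (∑ u ∈ Finset.univ.erase j, |h u|) ^ 2 * P) := by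
  set g := ∑ u ∈ Finset.univ.erase j, |h u|
  obtain ⟨v, hv⟩ : ∃ v : NNReal, (v : ℝ) = 1 + g ^ 2 * P := ⟨⟨1 + g ^ 2 * P, by positivity⟩, rfl⟩
  have hv0 : v ≠ 0 := NNReal.coe_ne_zero.1 (by rw [hv]; positivity)
  have hM0 : M ≠ 0 := by
    rintro rfl
    exact Fintype.card_ne_zero (hM.trans (zero_mul _))
  have hdivergence := hc.neg_integral_log_likelihoodRatio_le hv0
    (hv ▸ hc.sum_integral_residual_sq_le hP j)
  have hfano := measureReal_mul_log_le_log_two_sub_integral_log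
    (D := c.likelihoodRatio h j v)
    (ae_of_all _ fun ω => gaussianLikelihoodRatio_pos hv0 (c.residual h j ω.1 ω.2) ω.2.2)
    (hc.integrable_log_likelihoodRatio j hv0) (c.lintegral_likelihoodRatio h j hv0).le
    (c.measurableSet_correct h) (Nat.cast_pos.2 (Nat.pos_of_ne_zero hM0))
    (hs.ofReal_mul_setLIntegral_correct_le_one hv0 hM)
  rw [c.measureReal_correct h] at hfano
  rw [hv] at hdivergence
  linarith

theorem PowerConstraint.one_sub_errorProb_mul_logb_le (hc : c.PowerConstraint h P) (hP : 0 ≤ P)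
    {j k l : Fin 3} (hjk : j ≠ k) (hjl : j ≠ l) (hkl : k ≠ l) :
    (1 - (c.errorProb h).toReal) *
        Real.logb 2 (Fintype.card (MessageSet R n k ⟨j, hjk⟩) *
          Fintype.card (MessageSet R n l ⟨j, hjl⟩) *
          Fintype.card (MessageSet R n k ⟨l, hkl.symm⟩) : ℕ) ≤
      1 + n * gaussianC ((|h k| + |h l|) ^ 2 * P) := by
  have hgenie := (isGenie_message (c := c) (h := h) hjk hjl hkl).one_sub_errorProb_mul_log_le hc hP
    (card_messages hjk hjl hkl)
  rw [univ_erase_eq_pair hkl hjk hjl, Finset.sum_pair hkl] at hgenie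
  have hlog : 0 < Real.log 2 := Real.log_pos one_lt_two
  rw [gaussianC, Real.logb, Real.logb, ← mul_div_assoc, div_le_iff₀ hlog]
  refine hgenie.trans_eq ?_
  field_simp

end Converse

end Code

section Rates

variable (hR : ∀ j k, 0 ≤ R j k)
include hR

theorem card_messageSet_pos (j : Fin 3) (k : Other j) :
    0 < Fintype.card (MessageSet R n j k) := by
  rw [Fintype.card_fin]
  exact Nat.floor_pos.2 (Real.one_le_rpow one_le_two (mul_nonneg n.cast_nonneg (hR j k)))

theorem nonempty_messages : Nonempty (Messages R n) :=
  ⟨fun j k => ⟨0, by simpa only [Fintype.card_fin] using card_messageSet_pos hR j k⟩⟩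

theorem mul_rates_sub_three_le_logb_card {j k l : Fin 3} (hjk : j ≠ k) (hjl : j ≠ l)
    (hkl : k ≠ l) :
    n * (R k ⟨j, hjk⟩ + R l ⟨j, hjl⟩ + R k ⟨l, hkl.symm⟩) - 3 ≤
      Real.logb 2 (Fintype.card (MessageSet R n k ⟨j, hjk⟩) *
        Fintype.card (MessageSet R n l ⟨j, hjl⟩) *
        Fintype.card (MessageSet R n k ⟨l, hkl.symm⟩) : ℕ) := by
  have hne : ∀ u x, (Fintype.card (MessageSet R n u x) : ℝ) ≠ 0 := fun u x =>
    Nat.cast_ne_zero.2 (card_messageSet_pos hR u x).ne'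
  have hlogb : ∀ u x, n * R u x - 1 ≤ Real.logb 2 (Fintype.card (MessageSet R n u x)) :=
    fun u x => by
      rw [Fintype.card_fin]
      exact sub_one_le_logb_floor_two_rpow (mul_nonneg n.cast_nonneg (hR u x))
  rw [Nat.cast_mul, Nat.cast_mul, Real.logb_mul (mul_ne_zero (hne _ _) (hne _ _)) (hne _ _),
    Real.logb_mul (hne _ _) (hne _ _)]
  linarith [hlogb k ⟨j, hjk⟩, hlogb l ⟨j, hjl⟩, hlogb k ⟨l, hkl.symm⟩]

end Rates

end YChannel

theorem mainTheorem5 (h : Fin 3 → ℝ) (P : ℝ) (hP : 0 ≤ P)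
    (R : YChannel.RateTuple) (hR : YChannel.Achievable h P R)
    (j k l : Fin 3) (hjk : j ≠ k) (hjl : j ≠ l) (hkl : k ≠ l) :
    R k ⟨j, hjk⟩ + R l ⟨j, hjl⟩ + R k ⟨l, hkl.symm⟩ ≤
      YChannel.gaussianC ((|h k| + |h l|) ^ 2 * P) := by
  obtain ⟨hR0, c, hc, herr⟩ := hR
  have herr' : Tendsto (fun n => ((c n).errorProb h).toReal) atTop (𝓝 0) :=
    (ENNReal.tendsto_toReal ENNReal.zero_ne_top).comp herr
  refine le_of_tendsto_zero_of_one_sub_mul_le herr' (a := 3) (b := 1) fun n => ?_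
  have := YChannel.nonempty_messages (n := n) hR0
  have hprob : 0 ≤ 1 - ((c n).errorProb h).toReal := by
    rw [← (c n).measureReal_correct h]
    exact measureReal_nonneg
  exact (mul_le_mul_of_nonneg_left
    (YChannel.mul_rates_sub_three_le_logb_card hR0 hjk hjl hkl) hprob).trans
    ((hc n).one_sub_errorProb_mul_logb_le hP hjk hjl hkl)
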